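/- Let $g\in L^2(\mathbb R)$ and let $a,b\in\mathbb R$ with $ab>0$. For $x,\omega\in\mathbb R$ put $g_{x,\omega}(t)=e^{2\pi i\omega t}g(t-x)$, and let $\langle f,h\rangle=\int_{\mathbb R} f\,\overline h$. Suppose that $(g,a,b)$ generates a Gabor frame for $L^2(\mathbb R)$, i.e. there are constants $A,B>0$ such that $$A\|f\|^2\le\sum_{n,m\in\mathbb Z}|\langle f,g_{na,mb}\rangle|^2\le B\|f\|^2\qquad\text{for all } f\in L^2(\mathbb R).$$ Let $\gamma=S^{-1}g$ be the (canonical) dual window, that is, the unique $\gamma \in L^2(\mathbb R)$ with $S\gamma=g$, where $Sf=\sum_{n,m\in\mathbb Z}\langle f,g_{na,mb}\rangle g_{na,mb}$ is the frame operator. For $n=0,1,2,\dots$ let $$H_n:L^2(\mathbb R)\to\mathbb C^{(2n+1)^2},\qquad H_nf=\{\langle f,g_{k/b,l/a}\rangle\}_{|k|,|l|\le n},$$ let $H_n^*$ be its adjoint, $H_n^*c=\sum_{|k|,|l|\le n}c_{k,l}\,g_{k/b,l/a}$, so that $$H_nH_n^*=\{\langle g_{k'/b,l'/a},g_{k/b,l/a}\rangle\}_{|k|,|l|\le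 n;\ |k'|,|l'|\le n}$$ is a finite section of the Gram matrix of the adjoint system $(g,1/b,1/a)$, and let $\sigma^{(n)}=\{ab\,\delta_{k0}\delta_{l0}\}_{|k|,|l|\le n}$. Then the dual window exists and is unique, the matrix $H_nH_n^*$ is invertible for every $n\ge 0$, and the functions $$\gamma^{(n)}=H_n^*(H_nH_n^*)^{-1}\sigma^{(n)}$$ satisfy $\|\gamma-\gamma^{(n)}\|_{L^2(\mathbb R)}\to0$ as $n\to\infty$. -/

import Mathlib

open MeasureTheory Filter Topology

namespace GaborFrame

/-- The Hilbert space `L²(ℝ)` of complex-valued functions. -/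
abbrev L2R : Type := Lp ℂ 2 (volume : Measure ℝ)

theorem memLp_shift (g : L2R) (x ω : ℝ) :
    MemLp (fun t : ℝ => Complex.exp (2 * Real.pi * Complex.I * ω * t) * g (t - x)) 2 volume := by
  have h : MemLp (fun t : ℝ => g (t - x)) 2 volume :=
    (Lp.memLp g).comp_measurePreserving (measurePreserving_sub_right volume x)
  refine h.of_le (AEStronglyMeasurable.mul (by fun_prop) h.1) (Eventually.of_forall fun t => ?_)
  have e : (2 * Real.pi * Complex.I * ω * t : ℂ) = ((2 * Real.pi * ω * t : ℝ) : ℂ) * Complex.I := by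
    push_cast
    ring
  rw [norm_mul, e, Complex.norm_exp_ofReal_mul_I, one_mul]

/-- The time-frequency shift `g_{x,ω}(t) = exp(2πiωt) g(t - x)`, as an element of `L²(ℝ)`. -/
noncomputable def shift (g : L2R) (x ω : ℝ) : L2R := (memLp_shift g x ω).toLp

/-- The Gabor system `(g, α, β)`: the functions `g_{nα,mβ}`, indexed by `(n, m) ∈ ℤ × ℤ`. -/
noncomputable def atom (g : L2R) (α β : ℝ) (p : ℤ × ℤ) : L2R := shift g (p.1 * α) (p.2 * β)

/-- `(g, a, b)` generates a Gabor frame for `L²(ℝ)`.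
(Here `⟨f, h⟩ = ∫ f h̅` is linear in `f`, which is `inner ℂ h f` in Mathlib.) -/
def IsFrame (g : L2R) (a b : ℝ) : Prop :=
  ∃ A B : ℝ, 0 < A ∧ 0 < B ∧ ∀ f : L2R,
    Summable (fun p : ℤ × ℤ => ‖inner ℂ (atom g a b p) f‖ ^ 2) ∧
    A * ‖f‖ ^ 2 ≤ ∑' p : ℤ × ℤ, ‖inner ℂ (atom g a b p) f‖ ^ 2 ∧
    ∑' p : ℤ × ℤ, ‖inner ℂ (atom g a b p) f‖ ^ 2 ≤ B * ‖f‖ ^ 2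

/-- `γ` is the (canonical) dual window of `(g, a, b)`: `γ = S⁻¹ g`, that is `S γ = g`, where
`S f = ∑ ⟨f, g_{na,mb}⟩ g_{na,mb}` is the frame operator. -/
def IsDualWindow (g : L2R) (a b : ℝ) (γ : L2R) : Prop :=
  HasSum (fun p : ℤ × ℤ => (inner ℂ (atom g a b p) γ : ℂ) • atom g a b p) g

/-- The adjoint Gabor system `(g, 1/b, 1/a)`: the functions `g_{k/b,l/a}`. -/
noncomputable def adjAtom (g : L2R) (a b : ℝ) (p : ℤ × ℤ) : L2R := atom g (1 / b) (1 / a) p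

/-- The Gram matrix `H H* = (⟨g_{k'/b,l'/a}, g_{k/b,l/a}⟩)` with rows `(k,l)`, columns `(k',l')`. -/
noncomputable def gram (g : L2R) (a b : ℝ) : Matrix (ℤ × ℤ) (ℤ × ℤ) ℂ :=
  Matrix.of fun p q => inner ℂ (adjAtom g a b p) (adjAtom g a b q)

/-- The sequence `σ_{k,l} = ab δ_{k0} δ_{l0}`. -/
noncomputable def sigma (a b : ℝ) (p : ℤ × ℤ) : ℂ := if p = (0, 0) then ((a * b : ℝ) : ℂ) else 0

/-- The index set `max(|k|, |l|) ≤ n`. -/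
abbrev Box (n : ℕ) : Type := ↥(Finset.Icc (-(n : ℤ)) n ×ˢ Finset.Icc (-(n : ℤ)) n)

/-- `H_n f = (⟨f, g_{k/b,l/a}⟩)_{|k|,|l| ≤ n}`. -/
noncomputable def analysis (g : L2R) (a b : ℝ) (n : ℕ) : L2R →L[ℂ] EuclideanSpace ℂ (Box n) :=
  (EuclideanSpace.equiv (Box n) ℂ).symm.toContinuousLinearMap ∘L
    ContinuousLinearMap.pi fun p => innerSL ℂ (adjAtom g a b p)

/-- The finite section `H_n H_n*` of the Gram matrix. -/
noncomputable def gramSection (g : L2R) (a b : ℝ) (n : ℕ) : Matrix (Box n) (Box n) ℂ :=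
  (gram g a b).submatrix Subtype.val Subtype.val

/-- `σ^(n)`, the restriction of `σ` to `|k|, |l| ≤ n`. -/
noncomputable def sigmaSection (a b : ℝ) (n : ℕ) : Box n → ℂ := fun p => sigma a b p

/-- `γ^(n) = H_n* (H_n H_n*)⁻¹ σ^(n)`. -/
noncomputable def approxDual (g : L2R) (a b : ℝ) (n : ℕ) : L2R :=
  ContinuousLinearMap.adjoint (analysis g a b n)
    (WithLp.toLp 2 ((gramSection g a b n)⁻¹.mulVec (sigmaSection a b n)))

theorem analysis_apply (g : L2R) (a b : ℝ) (n : ℕ) (f : L2R) (p : Box n) :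
    analysis g a b n f p = inner ℂ (adjAtom g a b p) f := rfl

/-- `H_n* c = ∑ c_{k,l} g_{k/b,l/a}`. -/
theorem adjoint_analysis_apply (g : L2R) (a b : ℝ) (n : ℕ) (c : EuclideanSpace ℂ (Box n)) :
    ContinuousLinearMap.adjoint (analysis g a b n) c = ∑ p : Box n, c p • adjAtom g a b p := by
  refine ext_inner_right ℂ fun f => ?_
  rw [ContinuousLinearMap.adjoint_inner_left, PiLp.inner_apply, sum_inner]
  refine Finset.sum_congr rfl fun p _ => ?_
  rw [analysis_apply, inner_smul_left, RCLike.inner_apply, mul_comm]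

/-- `gramSection` is the matrix of the operator `H_n H_n*`. -/
theorem gramSection_mulVec (g : L2R) (a b : ℝ) (n : ℕ) (c : EuclideanSpace ℂ (Box n)) :
    WithLp.toLp 2 ((gramSection g a b n).mulVec c) =
      analysis g a b n (ContinuousLinearMap.adjoint (analysis g a b n) c) := by
  ext p
  rw [analysis_apply, adjoint_analysis_apply, inner_sum]
  refine Finset.sum_congr rfl fun q _ => ?_
  rw [inner_smul_right, mul_comm]
  rfl

end GaborFrame

namespace GaborFrame

open scoped FourierTransform ComplexConjugate

/-! Let V be the closed span of the adjoint system. Two facts about γ suffice: the Wexler-Raz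
relations ⟨γ, g_{k/b,l/a}⟩ = ab δ_{k0} δ_{l0}, and γ ∈ V. By the first, γ^(n) has the same inner
products as γ with the atoms in the n-th box, so it is the orthogonal projection of γ onto their
span (`norm_sub_approxDual_le`). These spans increase to a dense subspace of V, and the second fact
gives convergence. Wexler-Raz also makes the adjoint atoms linearly independent, hence every Gram
section invertible.

Both facts come from one identity. For a mixed frame operator T, the coefficient of T at
simultaneously shifted f₁, f₂ is the periodization over the lattice of a product of two short-time
Fourier transforms. Unfolding and Moyal's relation give its Fourier coefficients
(`integral_shiftedCoeff`), in which the adjoint lattice appears. With T the identity this is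
Wexler-Raz. With T = S it shows that S maps V into V; positivity of S then forces γ ∈ V. -/

/-! ### Time-frequency shifts and their commutation relations -/

theorem coeFn_shift (g : L2R) (x ω : ℝ) :
    shift g x ω =ᵐ[volume] fun t => (Real.fourierChar (ω * t) : ℂ) * g (t - x) := by
  filter_upwards [(memLp_shift g x ω).coeFn_toLp] with t ht
  rw [shift, ht, Real.fourierChar_apply]
  congr 2
  push_cast
  ring

theorem ae_comp_sub {p : ℝ → Prop} (h : ∀ᵐ t, p t) (x : ℝ) : ∀ᵐ t : ℝ, p (t - x) :=
  (measurePreserving_sub_right volume x).quasiMeasurePreserving.ae h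

theorem shift_add (f g : L2R) (x ω : ℝ) : shift (f + g) x ω = shift f x ω + shift g x ω := by
  refine Lp.ext ?_
  filter_upwards [coeFn_shift (f + g) x ω, coeFn_shift f x ω, coeFn_shift g x ω,
    Lp.coeFn_add (shift f x ω) (shift g x ω), ae_comp_sub (Lp.coeFn_add f g) x]
    with t h₁ h₂ h₃ h₄ h₅
  rw [h₁, h₄, Pi.add_apply, h₂, h₃, h₅, Pi.add_apply, mul_add]

theorem shift_smul (c : ℂ) (f : L2R) (x ω : ℝ) : shift (c • f) x ω = c • shift f x ω := by
  refine Lp.ext ?_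
  filter_upwards [coeFn_shift (c • f) x ω, coeFn_shift f x ω,
    Lp.coeFn_smul c (shift f x ω), ae_comp_sub (Lp.coeFn_smul c f) x] with t h₁ h₂ h₃ h₄
  rw [h₁, h₃, Pi.smul_apply, h₂, h₄, Pi.smul_apply, smul_eq_mul, smul_eq_mul, mul_left_comm]

theorem norm_shift (f : L2R) (x ω : ℝ) : ‖shift f x ω‖ = ‖f‖ := by
  rw [← Lp.norm_compMeasurePreserving f (measurePreserving_sub_right volume x)]
  refine le_antisymm (Lp.norm_le_norm_of_ae_le ?_) (Lp.norm_le_norm_of_ae_le ?_) <;>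
  · filter_upwards [coeFn_shift f x ω,
      Lp.coeFn_compMeasurePreserving f (measurePreserving_sub_right volume x)] with t h₁ h₂
    rw [h₁, h₂, norm_mul, Circle.norm_coe, one_mul]
    rfl

/-- The time-frequency shift as a linear isometry of `L²(ℝ)`. -/
noncomputable def shiftₗᵢ (x ω : ℝ) : L2R →ₗᵢ[ℂ] L2R where
  toFun f := shift f x ω
  map_add' f g := shift_add f g x ω
  map_smul' c f := shift_smul c f x ω
  norm_map' f := norm_shift f x ω

theorem inner_shift_shift (f g : L2R) (x ω : ℝ) :
    inner ℂ (shift f x ω) (shift g x ω) = inner ℂ f g :=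
  (shiftₗᵢ x ω).inner_map_map f g

theorem shift_shift (f : L2R) (x ω y η : ℝ) :
    shift (shift f x ω) y η = (Real.fourierChar (-(ω * y)) : ℂ) • shift f (x + y) (ω + η) := by
  refine Lp.ext ?_
  filter_upwards [coeFn_shift (shift f x ω) y η, coeFn_shift f (x + y) (ω + η),
    Lp.coeFn_smul (Real.fourierChar (-(ω * y)) : ℂ) (shift f (x + y) (ω + η)),
    ae_comp_sub (coeFn_shift f x ω) y] with t h₁ h₂ h₃ h₄
  rw [h₁, h₃, Pi.smul_apply, h₂, h₄, smul_eq_mul, ← mul_assoc, ← mul_assoc, ← Circle.coe_mul,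
    ← Circle.coe_mul, ← AddChar.map_add_eq_mul, ← AddChar.map_add_eq_mul,
    show t - (x + y) = t - y - x by ring]
  congr 3
  ring_nf

theorem shift_zero (f : L2R) : shift f 0 0 = f := by
  refine Lp.ext ?_
  filter_upwards [coeFn_shift f 0 0] with t h
  simp [h]

theorem shift_comm (f : L2R) (x ω y η : ℝ) :
    shift (shift f x ω) y η =
      (Real.fourierChar (η * x - ω * y) : ℂ) • shift (shift f y η) x ω := by
  rw [shift_shift, shift_shift, smul_smul, ← Circle.coe_mul, ← AddChar.map_add_eq_mul,
    add_comm x y, add_comm ω η]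
  congr 3
  ring_nf

theorem shift_shift_neg (f : L2R) (x ω : ℝ) :
    shift (shift f (-x) (-ω)) x ω = (Real.fourierChar (ω * x) : ℂ) • f := by
  rw [shift_shift, neg_add_cancel, neg_add_cancel, shift_zero, neg_mul, neg_neg]

/-! ### Strong continuity of the shifts -/

/-- The pointwise product whose Fourier transform is the short-time Fourier transform. -/
noncomputable def windowed (f g : L2R) (x : ℝ) (t : ℝ) : ℂ := f t * conj (g (t - x))

theorem memLp_comp_sub (g : L2R) (x : ℝ) : MemLp (fun t : ℝ => g (t - x)) 2 volume :=
  (Lp.memLp g).comp_measurePreserving (measurePreserving_sub_right volume x)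

theorem integrable_windowed (f g : L2R) (x : ℝ) : Integrable (windowed f g x) :=
  (Lp.memLp f).integrable_mul (memLp_comp_sub g x).star

theorem inner_shift_eq_fourier (f g : L2R) (x ω : ℝ) :
    inner ℂ (shift g x ω) f = 𝓕 (windowed f g x) ω := by
  rw [L2.inner_def, Real.fourier_real_eq]
  refine integral_congr_ae ?_
  filter_upwards [coeFn_shift g x ω] with t h
  rw [h, RCLike.inner_apply, map_mul, windowed, Circle.smul_def, smul_eq_mul, mul_comm t ω,
    AddChar.map_neg_eq_inv, Circle.coe_inv_eq_conj]
  ring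

theorem continuous_inner_shift_modulation (f g : L2R) :
    Continuous fun ω : ℝ => inner ℂ (shift g 0 ω) f := by
  simp_rw [inner_shift_eq_fourier]
  exact VectorFourier.fourierIntegral_continuous Real.continuous_fourierChar
    (by fun_prop) (integrable_windowed f g 0)

theorem continuous_shift_modulation (f : L2R) : Continuous fun ω : ℝ => shift f 0 ω := by
  refine continuous_iff_continuousAt.2 fun ω₀ => ?_
  rw [ContinuousAt, tendsto_iff_norm_sub_tendsto_zero]
  -- All the shifted vectors have the same norm, so weak continuity upgrades to norm continuity by
  -- expanding the square.
  have key : Tendsto (fun ω => ‖shift f 0 ω - shift f 0 ω₀‖ ^ 2) (𝓝 ω₀) (𝓝 0) := by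
    have h₁ : Continuous fun ω : ℝ => ‖f‖ ^ 2 - 2 * (inner ℂ (shift f 0 ω) (shift f 0 ω₀)).re
        + ‖f‖ ^ 2 :=
      ((continuous_const.sub (continuous_const.mul (Complex.continuous_re.comp
        (continuous_inner_shift_modulation (shift f 0 ω₀) f)))).add continuous_const)
    have h₂ := h₁.tendsto ω₀
    have h₃ : (inner ℂ (shift f 0 ω₀) (shift f 0 ω₀)).re = ‖f‖ ^ 2 := by
      rw [inner_shift_shift, inner_self_eq_norm_sq_to_K]
      norm_cast
    rw [h₃, show ‖f‖ ^ 2 - 2 * ‖f‖ ^ 2 + ‖f‖ ^ 2 = 0 by ring] at h₂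
    refine h₂.congr fun ω => ?_
    rw [norm_sub_sq (𝕜 := ℂ), norm_shift, norm_shift]
    rfl
  have := key.sqrt
  simpa [Real.sqrt_sq] using this

theorem continuous_shift_translation (f : L2R) : Continuous fun x : ℝ => shift f x 0 := by
  let τ : C(ℝ, C(ℝ, ℝ)) := ContinuousMap.curry ⟨fun p : ℝ × ℝ => p.2 - p.1, by fun_prop⟩
  have h : Continuous fun x : ℝ => Lp.compMeasurePreserving (τ x)
      (measurePreserving_sub_right volume x) f :=
    continuous_const.compMeasurePreservingLp τ.continuous _ (by simp)
  refine h.congr fun x => Lp.ext ?_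
  filter_upwards [coeFn_shift f x 0,
    Lp.coeFn_compMeasurePreserving f (measurePreserving_sub_right volume x)] with t h₁ h₂
  rw [h₁, zero_mul, AddChar.map_zero_eq_one, Circle.coe_one, one_mul]
  exact h₂

theorem continuous_shift (f : L2R) : Continuous fun z : ℝ × ℝ => shift f z.1 z.2 := by
  have h : ∀ x ω, shift f x ω = shift (shift f x 0) 0 ω := fun x ω => by
    rw [shift_shift, zero_mul, neg_zero, AddChar.map_zero_eq_one, Circle.coe_one, one_smul,
      add_zero, zero_add]
  refine continuous_iff_continuousAt.2 fun z₀ => ?_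
  rw [ContinuousAt, tendsto_iff_norm_sub_tendsto_zero]
  have h₁ : Tendsto (fun z : ℝ × ℝ => ‖shift f z.1 0 - shift f z₀.1 0‖ +
      ‖shift (shift f z₀.1 0) 0 z.2 - shift (shift f z₀.1 0) 0 z₀.2‖) (𝓝 z₀) (𝓝 0) := by
    have c : Continuous fun z : ℝ × ℝ => ‖shift f z.1 0 - shift f z₀.1 0‖ +
        ‖shift (shift f z₀.1 0) 0 z.2 - shift (shift f z₀.1 0) 0 z₀.2‖ :=
      ((((continuous_shift_translation f).comp continuous_fst).sub continuous_const).norm).add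
        ((((continuous_shift_modulation _).comp continuous_snd).sub continuous_const).norm)
    simpa using c.tendsto z₀
  refine squeeze_zero (fun _ => norm_nonneg _) (fun z => ?_) h₁
  rw [h z.1 z.2, h z₀.1 z₀.2]
  refine (norm_sub_le_norm_sub_add_norm_sub _ (shift (shift f z₀.1 0) 0 z.2) _).trans ?_
  refine add_le_add_left (le_of_eq ?_) _
  exact ((shiftₗᵢ 0 z.2).map_sub _ _ ▸ (shiftₗᵢ 0 z.2).norm_map _ :)

/-! ### Plancherel and Moyal's orthogonality relations -/

/-- Both transforms move onto a smooth compactly supported test function: the `Lp` one by its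
definition on tempered distributions, the integral one by Fubini. -/
theorem coeFn_fourier_toLp {u : ℝ → ℂ} (h₁ : Integrable u) (h₂ : MemLp u 2 volume) :
    (𝓕 (h₂.toLp u) : L2R) =ᵐ[volume] 𝓕 u := by
  have hc : Continuous (𝓕 u) := VectorFourier.fourierIntegral_continuous
    Real.continuous_fourierChar (by fun_prop) h₁
  refine ae_eq_of_integral_contDiff_smul_eq
    ((Lp.memLp _).locallyIntegrable (by norm_num)) hc.locallyIntegrable fun φ hφ hφc => ?_
  have hψc : HasCompactSupport (fun x => (φ x : ℂ)) := hφc.comp_left (g := Complex.ofReal) rfl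
  have hψ : ContDiff ℝ (⊤ : ℕ∞) (fun x => (φ x : ℂ)) := Complex.ofRealCLM.contDiff.comp hφ
  let ψ : SchwartzMap ℝ ℂ := hψc.toSchwartzMap hψ
  have e := congrArg (fun T : TemperedDistribution ℝ ℂ => T ψ)
    (Lp.fourier_toTemperedDistribution_eq (h₂.toLp u))
  simp only [TemperedDistribution.fourier_apply, Lp.toTemperedDistribution_apply] at e
  have flip : ∫ x, (𝓕 (ψ : ℝ → ℂ)) x • u x = ∫ x, ψ x • 𝓕 u x := by
    simpa using! VectorFourier.integral_fourierIntegral_smul_eq_flip (L := innerₗ ℝ)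
      Real.continuous_fourierChar continuous_inner ψ.integrable h₁
  calc ∫ x, φ x • (𝓕 (h₂.toLp u) : L2R) x = ∫ x, ψ x • (𝓕 (h₂.toLp u) : L2R) x := rfl
    _ = ∫ x, (𝓕 ψ) x • (h₂.toLp u) x := e.symm
    _ = ∫ x, (𝓕 (ψ : ℝ → ℂ)) x • u x := by
      refine integral_congr_ae ?_
      filter_upwards [h₂.coeFn_toLp] with x hx
      rw [hx, SchwartzMap.fourier_coe]
    _ = ∫ x, φ x • 𝓕 u x := flip

theorem memLp_fourier {u : ℝ → ℂ} (h₁ : Integrable u) (h₂ : MemLp u 2 volume) :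
    MemLp (𝓕 u) 2 volume :=
  (memLp_congr_ae (coeFn_fourier_toLp h₁ h₂)).1 (Lp.memLp _)

theorem integral_fourier_mul_conj_fourier {u v : ℝ → ℂ} (hu : Integrable u)
    (hu₂ : MemLp u 2 volume) (hv : Integrable v) (hv₂ : MemLp v 2 volume) :
    ∫ ω, 𝓕 u ω * conj (𝓕 v ω) = ∫ t, u t * conj (v t) := by
  have h := Lp.inner_fourier_eq (hv₂.toLp v) (hu₂.toLp u)
  rw [L2.inner_def, L2.inner_def] at h
  convert h using 1 <;> refine integral_congr_ae ?_
  · filter_upwards [coeFn_fourier_toLp hu hu₂, coeFn_fourier_toLp hv hv₂] with ω h₁ h₂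
    rw [h₁, h₂, RCLike.inner_apply]
  · filter_upwards [hu₂.coeFn_toLp, hv₂.coeFn_toLp] with ω h₁ h₂
    rw [h₁, h₂, RCLike.inner_apply]

/-- The short-time Fourier transform. -/
noncomputable def stft (f g : L2R) (z : ℝ × ℝ) : ℂ := inner ℂ (shift g z.1 z.2) f

theorem continuous_stft (f g : L2R) : Continuous (stft f g) :=
  (continuous_shift g).inner continuous_const

theorem stft_eq_fourier (f g : L2R) (x : ℝ) : (fun ω => stft f g (x, ω)) = 𝓕 (windowed f g x) :=
  funext fun ω => inner_shift_eq_fourier f g x ω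

theorem integrable_mul_conj (f g : L2R) : Integrable fun t => f t * conj (g t) :=
  (Lp.memLp f).integrable_mul (Lp.memLp g).star

theorem integral_mul_conj (f g : L2R) : ∫ t, f t * conj (g t) = inner ℂ g f := by
  rw [L2.inner_def]
  rfl

/-- Exhibits the product as the integrand of a convolution of two integrable functions, so that
Fubini applies in (x, t). -/
theorem windowed_mul_conj (f₁ f₂ g₁ g₂ : L2R) (x t : ℝ) :
    windowed f₁ g₁ x t * conj (windowed f₂ g₂ x t) =
      ContinuousLinearMap.mul ℝ ℂ (f₁ t * conj (f₂ t))
        ((fun s => g₂ (-s) * conj (g₁ (-s))) (x - t)) := by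
  simp only [windowed, map_mul, Complex.conj_conj, ContinuousLinearMap.mul_apply', neg_sub]
  ring

theorem integrable_windowed_mul_conj (f₁ f₂ g₁ g₂ : L2R) :
    Integrable (fun z : ℝ × ℝ => windowed f₁ g₁ z.1 z.2 * conj (windowed f₂ g₂ z.1 z.2))
      (volume.prod volume) := by
  simp_rw [windowed_mul_conj]
  exact (integrable_mul_conj f₁ f₂).convolution_integrand (ContinuousLinearMap.mul ℝ ℂ)
    (integrable_mul_conj g₂ g₁).comp_neg

theorem integral_integral_windowed_mul_conj (f₁ f₂ g₁ g₂ : L2R) :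
    ∫ x, ∫ t, windowed f₁ g₁ x t * conj (windowed f₂ g₂ x t) =
      inner ℂ f₂ f₁ * inner ℂ g₁ g₂ := by
  simp_rw [windowed_mul_conj]
  have h := integral_convolution (ContinuousLinearMap.mul ℝ ℂ) (μ := volume) (ν := volume)
    (integrable_mul_conj f₁ f₂) (integrable_mul_conj g₂ g₁).comp_neg
  rw [integral_neg_eq_self (fun s => g₂ s * conj (g₁ s)), integral_mul_conj, integral_mul_conj] at h
  exact h

/-- For an individual x the product of two L² functions is only integrable; Fubini gives square
integrability for almost every x, which is enough for Plancherel in ω. -/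
theorem ae_memLp_windowed (f g : L2R) : ∀ᵐ x, MemLp (windowed f g x) 2 volume := by
  filter_upwards [(integrable_windowed_mul_conj f f g g).prod_right_ae] with x hx
  refine (memLp_two_iff_integrable_sq_norm (integrable_windowed f g x).1).2 ?_
  refine hx.norm.congr (Eventually.of_forall fun t => ?_)
  simp only [norm_mul, RCLike.norm_conj, sq]

theorem memLp_stft (f g : L2R) : MemLp (stft f g) 2 (volume.prod volume) := by
  refine (memLp_two_iff_integrable_sq_norm (continuous_stft f g).aestronglyMeasurable).2 ?_
  have e : ∀ᵐ x, ∫ ω, ‖stft f g (x, ω)‖ ^ 2 = ∫ t, ‖windowed f g x t‖ ^ 2 := by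
    filter_upwards [ae_memLp_windowed f g] with x hx
    have h := integral_fourier_mul_conj_fourier (integrable_windowed f g x) hx
      (integrable_windowed f g x) hx
    rw [← stft_eq_fourier] at h
    simp only [RCLike.mul_conj] at h
    exact_mod_cast h
  refine (integrable_prod_iff (by have := continuous_stft f g; fun_prop)).2 ⟨?_, ?_⟩
  · filter_upwards [ae_memLp_windowed f g] with x hx
    have h := memLp_fourier (integrable_windowed f g x) hx
    rw [← stft_eq_fourier] at h
    exact h.integrable_norm_pow two_ne_zero
  · refine (integrable_windowed_mul_conj f f g g).norm.integral_prod_left.congr ?_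
    filter_upwards [e] with x hx
    simp only [norm_mul, RCLike.norm_conj, norm_pow, norm_norm, hx, ← sq]

theorem integrable_stft_mul_conj_stft (f₁ f₂ g₁ g₂ : L2R) :
    Integrable (fun z => stft f₁ g₁ z * conj (stft f₂ g₂ z)) (volume.prod volume) :=
  (memLp_stft f₁ g₁).integrable_mul (memLp_stft f₂ g₂).star

/-- Moyal's orthogonality relations for the short-time Fourier transform. -/
theorem integral_stft_mul_conj_stft (f₁ f₂ g₁ g₂ : L2R) :
    ∫ z, stft f₁ g₁ z * conj (stft f₂ g₂ z) ∂(volume.prod volume) =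
      inner ℂ f₂ f₁ * inner ℂ g₁ g₂ := by
  rw [integral_prod _ (integrable_stft_mul_conj_stft f₁ f₂ g₁ g₂),
    ← integral_integral_windowed_mul_conj]
  refine integral_congr_ae ?_
  filter_upwards [ae_memLp_windowed f₁ g₁, ae_memLp_windowed f₂ g₂] with x h₁ h₂
  rw [← integral_fourier_mul_conj_fourier (integrable_windowed f₁ g₁ x) h₁
    (integrable_windowed f₂ g₂ x) h₂, ← stft_eq_fourier, ← stft_eq_fourier]

/-! ### Uniqueness of Fourier coefficients and periodization -/

theorem eq_zero_of_periodic_of_integral_fourierChar_eq_zero {T : ℝ} (hT : 0 < T) {f : ℝ → ℂ}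
    (hf : Continuous f) (hp : Function.Periodic f T)
    (h : ∀ n : ℤ, ∫ t in (0 : ℝ)..T, (Real.fourierChar (n * t / T) : ℂ) * f t = 0) (t : ℝ) :
    f t = 0 := by
  have : Fact (0 < T) := ⟨hT⟩
  let F : C(AddCircle T, ℂ) := ⟨hp.lift, continuous_coinduced_dom.2 hf⟩
  have hF : fourierCoeff F = 0 := by
    funext n
    rw [fourierCoeff_eq_intervalIntegral F n 0, zero_add, Pi.zero_apply]
    refine (congrArg (fun z : ℂ => (1 / T) • z) ?_).trans (smul_zero _)
    rw [← h (-n)]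
    refine intervalIntegral.integral_congr fun t _ => ?_
    change _ • f t = _
    rw [fourier_coe_apply, Real.fourierChar_apply, smul_eq_mul]
    congr 2
    push_cast
    ring
  -- The zero coefficients are trivially summable, so the Fourier series converges to the continuous
  -- function F.
  have := hasSum_fourier_series_of_summable (f := F) (by rw [hF]; exact summable_zero)
  simp only [hF, Pi.zero_apply, zero_smul] at this
  have h0 : F = 0 := this.unique hasSum_zero
  exact DFunLike.congr_fun h0 (t : AddCircle T)

theorem eq_zero_of_biperiodic_of_integral_fourierChar_eq_zero {a b : ℝ} (ha : 0 < a) (hb : 0 < b)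
    {Φ : ℝ × ℝ → ℂ} (hΦ : Continuous Φ) (h₁ : ∀ x ω, Φ (x + a, ω) = Φ (x, ω))
    (h₂ : ∀ x ω, Φ (x, ω + b) = Φ (x, ω))
    (h : ∀ k l : ℤ, ∫ x in (0 : ℝ)..a, ∫ ω in (0 : ℝ)..b,
      (Real.fourierChar (l * (1 / a) * x - ω * (k * (1 / b))) : ℂ) * Φ (x, ω) = 0) (z : ℝ × ℝ) :
    Φ z = 0 := by
  have step : ∀ (k : ℤ) (x : ℝ),
      ∫ ω in (0 : ℝ)..b, (Real.fourierChar (k * ω / b) : ℂ) * Φ (x, ω) = 0 := by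
    intro k
    refine eq_zero_of_periodic_of_integral_fourierChar_eq_zero ha ?_ ?_ fun l => ?_
    · refine intervalIntegral.continuous_parametric_intervalIntegral_of_continuous' ?_ _ _
      have := Real.continuous_fourierChar
      fun_prop
    · intro x
      simp only [h₁]
    · rw [← h (-k) l]
      refine intervalIntegral.integral_congr fun x _ => ?_
      change _ * (∫ _ in (0 : ℝ)..b, _) = _
      rw [← intervalIntegral.integral_const_mul]
      refine intervalIntegral.integral_congr fun ω _ => ?_
      rw [← mul_assoc, ← Circle.coe_mul, ← AddChar.map_add_eq_mul]
      congr 3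
      push_cast
      ring_nf
  obtain ⟨x, ω⟩ := z
  exact eq_zero_of_periodic_of_integral_fourierChar_eq_zero hb
    (f := fun ω => Φ (x, ω)) (by fun_prop) (h₂ x) (fun k => step k x) ω

/-- The lattice translates `E p` of the half-open cell `D` tile the plane. -/
theorem integral_periodization {a b : ℝ} (ha : 0 < a) (hb : 0 < b) {F Φ : ℝ × ℝ → ℂ}
    (hF : Integrable F (volume.prod volume))
    (hΦ : ∀ x ω, HasSum (fun p : ℤ × ℤ => F (x + p.1 * a, ω + p.2 * b)) (Φ (x, ω)))
    (hc : Continuous Φ) :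
    ∫ x in (0 : ℝ)..a, ∫ ω in (0 : ℝ)..b, Φ (x, ω) = ∫ z, F z ∂(volume.prod volume) := by
  let v : ℤ × ℤ → ℝ × ℝ := fun p => (p.1 * a, p.2 * b)
  let D : Set (ℝ × ℝ) := Set.Ioc 0 a ×ˢ Set.Ioc 0 b
  let E : ℤ × ℤ → Set (ℝ × ℝ) := fun p => (fun z => z - v p) ⁻¹' D
  have hD : MeasurableSet D := measurableSet_Ioc.prod measurableSet_Ioc
  have hE : ∀ p, MeasurableSet (E p) := fun p => (measurable_id.sub_const _) hD
  have hmp : ∀ p, MeasurePreserving (fun z : ℝ × ℝ => z - v p) (volume.prod volume)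
      (volume.prod volume) := fun p => measurePreserving_sub_right _ _
  have hemb : ∀ p, MeasurableEmbedding (fun z : ℝ × ℝ => z - v p) := fun p =>
    (MeasurableEquiv.subRight (v p)).measurableEmbedding
  have mem_iff : ∀ p z, z ∈ E p ↔
      (z.1 - p.1 • a ∈ Set.Ioc 0 (0 + a) ∧ z.2 - p.2 • b ∈ Set.Ioc 0 (0 + b)) := by
    intro p z
    simp [E, D, v]
  have hdisj : Pairwise (Function.onFun Disjoint E) := by
    intro p q hpq
    refine Set.disjoint_left.2 fun z hz hz' => hpq ?_
    rw [mem_iff] at hz hz'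
    exact Prod.ext ((existsUnique_sub_zsmul_mem_Ioc ha z.1 0).unique hz.1 hz'.1)
      ((existsUnique_sub_zsmul_mem_Ioc hb z.2 0).unique hz.2 hz'.2)
  have hun : ⋃ p, E p = Set.univ := by
    refine Set.eq_univ_of_forall fun z => Set.mem_iUnion.2 ?_
    obtain ⟨m, hm, -⟩ := existsUnique_sub_zsmul_mem_Ioc ha z.1 0
    obtain ⟨n, hn, -⟩ := existsUnique_sub_zsmul_mem_Ioc hb z.2 0
    exact ⟨(m, n), (mem_iff _ _).2 ⟨hm, hn⟩⟩
  have translate : ∀ {G : Type} [NormedAddCommGroup G] [NormedSpace ℝ G] (f : ℝ × ℝ → G) p,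
      ∫ z in E p, f z ∂(volume.prod volume) = ∫ z in D, f (z + v p) ∂(volume.prod volume) := by
    intro G _ _ f p
    have := (hmp p).setIntegral_preimage_emb (hemb p) (fun z => f (z + v p)) D
    simpa only [sub_add_cancel] using this
  have s₁ := hasSum_integral_iUnion hE hdisj (f := F) hF.integrableOn
  have s₂ := hasSum_integral_iUnion hE hdisj (f := fun z => ‖F z‖) hF.norm.integrableOn
  simp only [translate, hun, setIntegral_univ] at s₁ s₂
  have s₃ := hasSum_integral_of_summable_integral_norm
    (F := fun p z => F (z + v p)) (μ := (volume.prod volume).restrict D)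
    (fun p => ((measurePreserving_add_right _ (v p)).integrable_comp_of_integrable hF).integrableOn)
    s₂.summable
  rw [← s₃.unique s₁]
  have hs : ∀ z : ℝ × ℝ, ∑' p, F (z + v p) = Φ z := fun z => (hΦ z.1 z.2).tsum_eq
  simp only [hs]
  rw [setIntegral_prod, intervalIntegral.integral_of_le ha.le]
  · simp only [intervalIntegral.integral_of_le hb.le]
  · refine (hc.continuousOn.integrableOn_compact (K := Set.Icc 0 a ×ˢ Set.Icc 0 b)
      (isCompact_Icc.prod isCompact_Icc)).mono_set
      (Set.prod_mono Set.Ioc_subset_Icc_self Set.Ioc_subset_Icc_self)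

/-! ### Fourier coefficients of shifted matrix coefficients -/

theorem fourierChar_mul_conj (s : ℝ) :
    (Real.fourierChar s : ℂ) * conj (Real.fourierChar s : ℂ) = 1 := by
  rw [Complex.mul_conj, Circle.normSq_coe, Complex.ofReal_one]

theorem fourierChar_add_int (s : ℝ) (n : ℤ) :
    (Real.fourierChar (s + n) : ℂ) = Real.fourierChar s := by
  rw [AddChar.map_add_eq_mul, Circle.coe_mul, Real.fourierChar_apply n]
  have : Complex.exp (((2 * Real.pi * n : ℝ) : ℂ) * Complex.I) = 1 := by
    rw [← Complex.exp_int_mul_two_pi_mul_I n]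
    congr 1
    push_cast
    ring
  rw [this, mul_one]

/-- The character is the commutator phase of the two shifts; this is how a Fourier coefficient turns
into a shift of f₁ and g₁ by an adjoint lattice point. -/
theorem fourierChar_mul_stft (f g : L2R) (x ω y η : ℝ) :
    (Real.fourierChar (η * x - ω * y) : ℂ) * stft f g (x, ω) =
      stft (shift f y η) (shift g y η) (x, ω) := by
  rw [stft, ← inner_shift_shift _ _ y η, shift_comm, inner_smul_left, ← mul_assoc,
    fourierChar_mul_conj, one_mul, stft]

theorem inner_shift_shift_neg (f g : L2R) (x ω y η : ℝ) :
    inner ℂ (shift g y η) (shift f (-x) (-ω)) =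
      (Real.fourierChar (η * x + ω * x) : ℂ) * stft f g (x + y, ω + η) := by
  rw [← inner_shift_shift _ _ x ω, shift_shift, shift_shift_neg, inner_smul_left, inner_smul_right,
    AddChar.map_neg_eq_inv, Circle.coe_inv_eq_conj, Complex.conj_conj, ← mul_assoc,
    ← Circle.coe_mul, ← AddChar.map_add_eq_mul, stft, add_comm y x, add_comm η ω]

theorem inner_mul_inner_shift_neg (f₁ f₂ g₁ g₂ : L2R) (x ω y η : ℝ) :
    inner ℂ (shift g₁ y η) (shift f₁ (-x) (-ω)) * inner ℂ (shift f₂ (-x) (-ω)) (shift g₂ y η) =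
      stft f₁ g₁ (x + y, ω + η) * conj (stft f₂ g₂ (x + y, ω + η)) := by
  rw [← inner_conj_symm (shift f₂ (-x) (-ω)), inner_shift_shift_neg, inner_shift_shift_neg, map_mul,
    mul_mul_mul_comm, fourierChar_mul_conj, one_mul]

/-- `T` is the mixed frame operator `f ↦ ∑ ⟨f, g₁_{na,mb}⟩ g₂_{na,mb}`, in the weak sense. -/
def IsMixedFrameOperator (g₁ g₂ : L2R) (a b : ℝ) (T : L2R →L[ℂ] L2R) : Prop :=
  ∀ f h : L2R, HasSum (fun p : ℤ × ℤ => inner ℂ (atom g₁ a b p) f * inner ℂ h (atom g₂ a b p))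
    (inner ℂ h (T f))

/-- The matrix coefficient of `T` at the simultaneously shifted functions `f₁` and `f₂`. -/
noncomputable def shiftedCoeff (T : L2R →L[ℂ] L2R) (f₁ f₂ : L2R) (z : ℝ × ℝ) : ℂ :=
  inner ℂ (shift f₂ (-z.1) (-z.2)) (T (shift f₁ (-z.1) (-z.2)))

theorem continuous_shiftedCoeff (T : L2R →L[ℂ] L2R) (f₁ f₂ : L2R) :
    Continuous (shiftedCoeff T f₁ f₂) := by
  have h₁ : Continuous fun z : ℝ × ℝ => shift f₁ (-z.1) (-z.2) :=
    Continuous.comp (g := fun z : ℝ × ℝ => shift f₁ z.1 z.2)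
      (f := fun z : ℝ × ℝ => (-z.1, -z.2)) (continuous_shift f₁) (by fun_prop)
  have h₂ : Continuous fun z : ℝ × ℝ => shift f₂ (-z.1) (-z.2) :=
    Continuous.comp (g := fun z : ℝ × ℝ => shift f₂ z.1 z.2)
      (f := fun z : ℝ × ℝ => (-z.1, -z.2)) (continuous_shift f₂) (by fun_prop)
  exact h₂.inner (T.continuous.comp h₁)

theorem IsMixedFrameOperator.hasSum_shiftedCoeff {g₁ g₂ : L2R} {a b : ℝ} {T : L2R →L[ℂ] L2R}
    (hT : IsMixedFrameOperator g₁ g₂ a b T) (f₁ f₂ : L2R) (x ω : ℝ) :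
    HasSum (fun p : ℤ × ℤ => stft f₁ g₁ (x + p.1 * a, ω + p.2 * b) *
      conj (stft f₂ g₂ (x + p.1 * a, ω + p.2 * b))) (shiftedCoeff T f₁ f₂ (x, ω)) := by
  simp_rw [← inner_mul_inner_shift_neg]
  exact hT _ _

theorem IsMixedFrameOperator.integral_shiftedCoeff {g₁ g₂ : L2R} {a b : ℝ} (ha : 0 < a)
    (hb : 0 < b) {T : L2R →L[ℂ] L2R} (hT : IsMixedFrameOperator g₁ g₂ a b T) (f₁ f₂ : L2R)
    (k l : ℤ) :
    ∫ x in (0 : ℝ)..a, ∫ ω in (0 : ℝ)..b,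
      (Real.fourierChar (l * (1 / a) * x - ω * (k * (1 / b))) : ℂ) * shiftedCoeff T f₁ f₂ (x, ω) =
      inner ℂ f₂ (shift f₁ (k * (1 / b)) (l * (1 / a))) *
        inner ℂ (shift g₁ (k * (1 / b)) (l * (1 / a))) g₂ := by
  rw [← integral_stft_mul_conj_stft]
  refine integral_periodization ha hb (Φ := fun z : ℝ × ℝ =>
    (Real.fourierChar (l * (1 / a) * z.1 - z.2 * (k * (1 / b))) : ℂ) * shiftedCoeff T f₁ f₂ z)
    (integrable_stft_mul_conj_stft _ _ _ _) (fun x ω => ?_) ?_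
  · refine ((hT.hasSum_shiftedCoeff f₁ f₂ x ω).mul_left _).congr_fun fun p => ?_
    -- Translation by (p.1 a, p.2 b) changes the argument of the character by the integer l p.1 -
    -- p.2 k, because the frequencies lie in the adjoint lattice.
    rw [← fourierChar_mul_stft, mul_assoc (Real.fourierChar _ : ℂ),
      ← fourierChar_add_int (l * (1 / a) * x - ω * (k * (1 / b))) (l * p.1 - p.2 * k)]
    congr 3
    push_cast
    field_simp
    ring
  · have := Real.continuous_fourierChar
    have := continuous_shiftedCoeff T f₁ f₂
    fun_prop

/-- All Fourier coefficients of the continuous biperiodic function `shiftedCoeff T f₁ f₂` vanish;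
its value at the origin is the claim. -/
theorem IsMixedFrameOperator.inner_eq_zero {g₁ g₂ : L2R} {a b : ℝ} (ha : 0 < a)
    (hb : 0 < b) {T : L2R →L[ℂ] L2R} (hT : IsMixedFrameOperator g₁ g₂ a b T) {f₁ f₂ : L2R}
    (h : ∀ k l : ℤ, inner ℂ f₂ (shift f₁ (k * (1 / b)) (l * (1 / a))) = 0) :
    inner ℂ f₂ (T f₁) = 0 := by
  have key := eq_zero_of_biperiodic_of_integral_fourierChar_eq_zero ha hb
    (continuous_shiftedCoeff T f₁ f₂) (fun x ω => ?_) (fun x ω => ?_)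
    (fun k l => by rw [hT.integral_shiftedCoeff ha hb, h, zero_mul]) (0, 0)
  · simpa [shiftedCoeff, shift_zero] using key
  · refine (hT.hasSum_shiftedCoeff f₁ f₂ (x + a) ω).unique ?_
    refine ((Equiv.hasSum_iff (Equiv.addRight ((1, 0) : ℤ × ℤ))).2
      (hT.hasSum_shiftedCoeff f₁ f₂ x ω)).congr_fun fun p => ?_
    simp only [Function.comp_apply, Equiv.coe_addRight, Prod.fst_add, Prod.snd_add, add_zero,
      Int.cast_add, Int.cast_one, add_mul, one_mul, add_assoc, add_comm a]
  · refine (hT.hasSum_shiftedCoeff f₁ f₂ x (ω + b)).unique ?_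
    refine ((Equiv.hasSum_iff (Equiv.addRight ((0, 1) : ℤ × ℤ))).2
      (hT.hasSum_shiftedCoeff f₁ f₂ x ω)).congr_fun fun p => ?_
    simp only [Function.comp_apply, Equiv.coe_addRight, Prod.fst_add, Prod.snd_add, add_zero,
      Int.cast_add, Int.cast_one, add_mul, one_mul, add_assoc, add_comm b]

theorem integral_fourierChar_eq_zero {T : ℝ} (hT : 0 < T) {n : ℤ} (hn : n ≠ 0) :
    ∫ t in (0 : ℝ)..T, (Real.fourierChar (n * (1 / T) * t) : ℂ) = 0 := by
  have hT' : (T : ℂ) ≠ 0 := by exact_mod_cast hT.ne'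
  have hc : (2 * Real.pi * Complex.I * n / T : ℂ) ≠ 0 := by
    have : (Real.pi : ℂ) ≠ 0 := by exact_mod_cast Real.pi_ne_zero
    have : (n : ℂ) ≠ 0 := by exact_mod_cast hn
    simp [*]
  have e : ∀ t : ℝ, (Real.fourierChar (n * (1 / T) * t) : ℂ) =
      Complex.exp (2 * Real.pi * Complex.I * n / T * t) := fun t => by
    rw [Real.fourierChar_apply]
    congr 1
    push_cast
    ring
  simp_rw [e]
  rw [integral_exp_mul_complex hc, div_mul_cancel₀ _ hT', Complex.ofReal_zero, mul_zero,
    Complex.exp_zero, mul_comm _ (n : ℂ), Complex.exp_int_mul_two_pi_mul_I, sub_self, zero_div]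

theorem integral_integral_fourierChar {a b : ℝ} (ha : 0 < a) (hb : 0 < b) (k l : ℤ) :
    ∫ x in (0 : ℝ)..a, ∫ ω in (0 : ℝ)..b,
      (Real.fourierChar (l * (1 / a) * x - ω * (k * (1 / b))) : ℂ) = sigma a b (k, l) := by
  have e : ∀ x ω : ℝ, (Real.fourierChar (l * (1 / a) * x - ω * (k * (1 / b))) : ℂ) =
      Real.fourierChar (l * (1 / a) * x) * Real.fourierChar ((-k : ℤ) * (1 / b) * ω) := by
    intro x ω
    rw [← Circle.coe_mul, ← AddChar.map_add_eq_mul]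
    congr 2
    push_cast
    ring
  simp_rw [e, intervalIntegral.integral_const_mul, intervalIntegral.integral_mul_const]
  rcases eq_or_ne l 0 with rfl | hl
  · rcases eq_or_ne k 0 with rfl | hk
    · simp [sigma]
    · rw [integral_fourierChar_eq_zero hb (neg_ne_zero.2 hk), mul_zero]
      simp [sigma, hk]
  · rw [integral_fourierChar_eq_zero ha hl, zero_mul]
    simp [sigma, hl]

theorem exists_inner_self_eq_one : ∃ f : L2R, inner ℂ f f = (1 : ℂ) := by
  refine ⟨indicatorConstLp 2 (measurableSet_Icc (a := (0 : ℝ)) (b := 1)) (by simp) (1 : ℂ), ?_⟩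
  rw [inner_self_eq_norm_sq_to_K, norm_indicatorConstLp (by simp) (by simp)]
  simp

/-- The Wexler-Raz biorthogonality relations. -/
theorem IsMixedFrameOperator.inner_adjAtom {g γ : L2R} {a b : ℝ} (ha : 0 < a) (hb : 0 < b)
    (hT : IsMixedFrameOperator g γ a b (ContinuousLinearMap.id ℂ L2R)) (p : ℤ × ℤ) :
    inner ℂ (adjAtom g a b p) γ = sigma a b p := by
  obtain ⟨k, l⟩ := p
  obtain ⟨f, hf⟩ := exists_inner_self_eq_one
  -- For T the identity the shifted coefficient is constant. Taking f₂ to be the shift of f₁ = f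
  -- makes the first factor on the right equal to ⟨f, f⟩ = 1.
  have h := hT.integral_shiftedCoeff ha hb f (shift f (k * (1 / b)) (l * (1 / a))) k l
  simp only [shiftedCoeff, ContinuousLinearMap.id_apply, inner_shift_shift,
    intervalIntegral.integral_mul_const, hf, one_mul, integral_integral_fourierChar ha hb] at h
  change inner ℂ (shift g (k * (1 / b)) (l * (1 / a))) γ = _
  rw [← h, sigma]
  split_ifs with h0
  · obtain ⟨rfl, rfl⟩ := Prod.mk.inj h0
    simp only [Int.cast_zero, zero_mul, shift_zero, hf, mul_one]
  · rw [zero_mul]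

/-! ### Frame operators -/

/-- The analysis operator of a Bessel family. -/
theorem exists_analysisOperator {ι H : Type*} [NormedAddCommGroup H] [InnerProductSpace ℂ H]
    (e : ι → H) (B : ℝ) (hs : ∀ f, Summable fun i => ‖inner ℂ (e i) f‖ ^ 2)
    (hB : ∀ f, ∑' i, ‖inner ℂ (e i) f‖ ^ 2 ≤ B * ‖f‖ ^ 2) :
    ∃ C : H →L[ℂ] lp (fun _ : ι => ℂ) 2,
      (∀ f i, C f i = inner ℂ (e i) f) ∧ ∀ f, ‖C f‖ ^ 2 = ∑' i, ‖inner ℂ (e i) f‖ ^ 2 := by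
  have hm : ∀ f, Memℓp (fun i => (inner ℂ (e i) f : ℂ)) 2 := fun f =>
    memℓp_gen (by simpa using hs f)
  let C₀ : H →ₗ[ℂ] lp (fun _ : ι => ℂ) 2 :=
    { toFun := fun f => ⟨fun i => inner ℂ (e i) f, hm f⟩
      map_add' := fun f g => by ext i; exact inner_add_right _ _ _
      map_smul' := fun c f => by ext i; exact inner_smul_right _ _ _ }
  have hn : ∀ f, ‖C₀ f‖ ^ 2 = ∑' i, ‖inner ℂ (e i) f‖ ^ 2 := fun f => by
    have h := lp.norm_rpow_eq_tsum (p := 2) (by norm_num) (C₀ f)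
    simp only [ENNReal.toReal_ofNat, Real.rpow_ofNat] at h
    exact h
  refine ⟨C₀.mkContinuous (Real.sqrt B) fun f => ?_, fun f i => rfl, hn⟩
  rw [← Real.sqrt_sq (norm_nonneg f), ← Real.sqrt_mul' _ (sq_nonneg _)]
  refine Real.le_sqrt_of_sq_le ?_
  rw [hn]
  exact hB f

theorem exists_frameOperator {ι H : Type*} [NormedAddCommGroup H] [InnerProductSpace ℂ H]
    [CompleteSpace H] (e : ι → H) (A B : ℝ) (hA : 0 < A)
    (hs : ∀ f, Summable fun i => ‖inner ℂ (e i) f‖ ^ 2)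
    (hl : ∀ f, A * ‖f‖ ^ 2 ≤ ∑' i, ‖inner ℂ (e i) f‖ ^ 2)
    (hB : ∀ f, ∑' i, ‖inner ℂ (e i) f‖ ^ 2 ≤ B * ‖f‖ ^ 2) :
    ∃ S : H ≃L[ℂ] H, (∀ f, HasSum (fun i => (inner ℂ (e i) f : ℂ) • e i) (S f)) ∧
      (∀ f h, inner ℂ (S f) h = (inner ℂ f (S h) : ℂ)) ∧
      ∀ f, A * ‖f‖ ^ 2 ≤ ‖(inner ℂ f (S f) : ℂ)‖ := by
  classical
  obtain ⟨C, hC, hn⟩ := exists_analysisOperator e B hs hB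
  let S₀ : H →L[ℂ] H := ContinuousLinearMap.adjoint C ∘L C
  have hsum : ∀ f, HasSum (fun i => (inner ℂ (e i) f : ℂ) • e i) (S₀ f) := fun f => by
    have h := (lp.hasSum_single (by norm_num) (C f)).mapL (ContinuousLinearMap.adjoint C)
    refine h.congr_fun fun i => ?_
    refine ext_inner_right ℂ fun u => ?_
    rw [ContinuousLinearMap.adjoint_inner_left, lp.inner_single_left, hC, hC, inner_smul_left,
      RCLike.inner_apply, mul_comm]
  have hsymm : ∀ f h, inner ℂ (S₀ f) h = (inner ℂ f (S₀ h) : ℂ) := fun f h => by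
    simp only [S₀, ContinuousLinearMap.comp_apply, ContinuousLinearMap.adjoint_inner_left,
      ContinuousLinearMap.adjoint_inner_right]
  have hc : ∀ f, A * ‖f‖ ^ 2 ≤ ‖(inner ℂ f (S₀ f) : ℂ)‖ := fun f => by
    simp only [S₀, ContinuousLinearMap.comp_apply, ContinuousLinearMap.adjoint_inner_right]
    rw [inner_self_eq_norm_sq_to_K, norm_pow, RCLike.norm_ofReal, abs_norm, hn]
    exact hl f
  -- The lower frame bound makes `S₀` coercive, hence invertible.
  have hu : IsUnit S₀ := ContinuousLinearMap.isUnit_of_forall_le_norm_inner_map S₀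
    (c := ⟨A, hA.le⟩) hA fun f => by
      rw [hsymm, mul_comm]
      exact hc f
  refine ⟨ContinuousLinearEquiv.ofUnit hu.unit, hsum, hsymm, hc⟩

theorem IsFrame.exists_frameOperator {g : L2R} {a b : ℝ} (hg : IsFrame g a b) :
    ∃ S : L2R ≃L[ℂ] L2R,
      (∀ f, HasSum (fun p => (inner ℂ (atom g a b p) f : ℂ) • atom g a b p) (S f)) ∧
      (∀ f h, inner ℂ (S f) h = (inner ℂ f (S h) : ℂ)) ∧
      ∀ f, inner ℂ f (S f) = (0 : ℂ) → f = 0 := by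
  obtain ⟨A, B, hA, -, h⟩ := hg
  obtain ⟨S, hS, hsymm, hc⟩ := GaborFrame.exists_frameOperator (atom g a b) A B hA
    (fun f => (h f).1) (fun f => (h f).2.1) (fun f => (h f).2.2)
  refine ⟨S, hS, hsymm, fun f hf => ?_⟩
  have := hc f
  rw [hf, norm_zero] at this
  by_contra hne
  have := norm_pos_iff.2 hne
  exact absurd ‹A * ‖f‖ ^ 2 ≤ 0› (not_le.2 (by positivity))

theorem shift_atom (g : L2R) (α β : ℝ) (p q : ℤ × ℤ) :
    ∃ c : ℂ, conj c * c = 1 ∧ shift (atom g α β p) (q.1 * α) (q.2 * β) = c • atom g α β (p + q) := by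
  refine ⟨Real.fourierChar (-(p.2 * β * (q.1 * α))), ?_, (shift_shift g _ _ _ _).trans ?_⟩
  · rw [mul_comm, fourierChar_mul_conj]
  · simp only [atom, Prod.fst_add, Prod.snd_add, Int.cast_add, add_mul]

theorem frameOperator_shift {g : L2R} {a b : ℝ} {S : L2R ≃L[ℂ] L2R}
    (hS : ∀ f, HasSum (fun p => (inner ℂ (atom g a b p) f : ℂ) • atom g a b p) (S f))
    (f : L2R) (q : ℤ × ℤ) :
    S (shift f (q.1 * a) (q.2 * b)) = shift (S f) (q.1 * a) (q.2 * b) := by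
  have h₁ := (Equiv.hasSum_iff (Equiv.addRight q)).2 (hS (shift f (q.1 * a) (q.2 * b)))
  have h₂ := (hS f).mapL (shiftₗᵢ (q.1 * a) (q.2 * b)).toContinuousLinearMap
  refine h₁.unique (h₂.congr_fun fun p => ?_)
  obtain ⟨c, hc, e⟩ := shift_atom g a b p q
  change inner ℂ (atom g a b (p + q)) _ • atom g a b (p + q) =
    shift (inner ℂ (atom g a b p) f • atom g a b p) _ _
  rw [shift_smul, ← inner_shift_shift (atom g a b p) f (q.1 * a) (q.2 * b), e, inner_smul_left,
    smul_smul, mul_right_comm, hc, one_mul]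

theorem IsFrame.inner_adjAtom_dualWindow {g γ : L2R} {a b : ℝ} (ha : 0 < a) (hb : 0 < b)
    (hg : IsFrame g a b) (hγ : IsDualWindow g a b γ) (p : ℤ × ℤ) :
    inner ℂ (adjAtom g a b p) γ = sigma a b p := by
  obtain ⟨S, hS, hsymm, -⟩ := hg.exists_frameOperator
  have hSγ : S γ = g := (hS γ).unique hγ
  refine IsMixedFrameOperator.inner_adjAtom ha hb (fun f h => ?_) p
  obtain ⟨h, rfl⟩ := S.surjective h
  -- S is symmetric and commutes with the lattice shifts, so it carries each shift of γ to that of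
  -- g. Testing against S h thus turns the mixed expansion into that of S, and the mixed operator is
  -- the identity.
  have e : ∀ q, inner ℂ (S h) (atom γ a b q) = (inner ℂ h (atom g a b q) : ℂ) := fun q => by
    rw [hsymm, atom, frameOperator_shift hS, hSγ, atom]
  simp only [e, ContinuousLinearMap.id_apply, hsymm]
  simpa only [innerSL_apply_apply, inner_smul_right] using (hS f).mapL (innerSL ℂ h)

/-! ### The dual window lies in the closed adjoint span -/

/-- The closed linear span of the adjoint system. -/
noncomputable def adjSpan (g : L2R) (a b : ℝ) : Submodule ℂ L2R :=
  (Submodule.span ℂ (Set.range (adjAtom g a b))).topologicalClosure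

theorem adjAtom_mem_adjSpan (g : L2R) (a b : ℝ) (p : ℤ × ℤ) : adjAtom g a b p ∈ adjSpan g a b :=
  Submodule.le_topologicalClosure _ (Submodule.subset_span ⟨p, rfl⟩)

theorem shift_mem_adjSpan {g : L2R} {a b : ℝ} (q : ℤ × ℤ) {f : L2R} (hf : f ∈ adjSpan g a b) :
    shift f (q.1 * (1 / b)) (q.2 * (1 / a)) ∈ adjSpan g a b := by
  let L : L2R →L[ℂ] L2R := (shiftₗᵢ (q.1 * (1 / b)) (q.2 * (1 / a))).toContinuousLinearMap
  have h : adjSpan g a b ≤ (adjSpan g a b).comap L.toLinearMap := by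
    refine Submodule.topologicalClosure_minimal _ (Submodule.span_le.2 ?_)
      ((Submodule.isClosed_topologicalClosure _).preimage L.continuous)
    rintro _ ⟨p, rfl⟩
    obtain ⟨c, -, e⟩ := shift_atom g (1 / b) (1 / a) p q
    change shift (atom g (1 / b) (1 / a) p) _ _ ∈ adjSpan g a b
    rw [e]
    exact Submodule.smul_mem _ _ (adjAtom_mem_adjSpan g a b (p + q))
  exact h hf

theorem IsFrame.dualWindow_mem_adjSpan {g γ : L2R} {a b : ℝ} (ha : 0 < a) (hb : 0 < b)
    (hg : IsFrame g a b) (hγ : IsDualWindow g a b γ) : γ ∈ adjSpan g a b := by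
  obtain ⟨S, hS, hsymm, hpos⟩ := hg.exists_frameOperator
  have hSγ : S γ = g := (hS γ).unique hγ
  have hT : IsMixedFrameOperator g g a b (S : L2R →L[ℂ] L2R) := fun f h => by
    simpa only [innerSL_apply_apply, inner_smul_right, ContinuousLinearEquiv.coe_coe]
      using (hS f).mapL (innerSL ℂ h)
  have : CompleteSpace (adjSpan g a b) :=
    (Submodule.isClosed_topologicalClosure _).completeSpace_coe
  obtain ⟨u, hu, v, hv, rfl⟩ := (adjSpan g a b).exists_add_mem_mem_orthogonal γ
  have hg0 : g ∈ adjSpan g a b := by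
    simpa [adjAtom, atom, shift_zero] using adjAtom_mem_adjSpan g a b (0, 0)
  -- The adjoint span is invariant under adjoint shifts, so v is orthogonal to every such shift of
  -- u.
  have huv : inner ℂ v (S u) = (0 : ℂ) := hT.inner_eq_zero ha hb fun k l =>
    Submodule.inner_left_of_mem_orthogonal (shift_mem_adjSpan (k, l) hu) hv
  -- Pairing v with g = S u + S v leaves ⟨S v, v⟩ = 0.
  have hv0 : v = 0 := hpos v <| by
    have := Submodule.inner_left_of_mem_orthogonal hg0 hv
    rwa [← hSγ, map_add, inner_add_right, huv, zero_add] at this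
  rwa [hv0, add_zero]

theorem atom_neg (g : L2R) (α β : ℝ) (p : ℤ × ℤ) : atom g (-α) (-β) p = atom g α β (-p) := by
  simp [atom]

theorem adjAtom_neg (g : L2R) (a b : ℝ) (p : ℤ × ℤ) :
    adjAtom g (-a) (-b) p = adjAtom g a b (-p) := by
  rw [adjAtom, adjAtom, ← atom_neg, one_div_neg_eq_neg_one_div, one_div_neg_eq_neg_one_div]

theorem IsFrame.neg {g : L2R} {a b : ℝ} (hg : IsFrame g a b) : IsFrame g (-a) (-b) := by
  obtain ⟨A, B, hA, hB, h⟩ := hg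
  refine ⟨A, B, hA, hB, fun f => ?_⟩
  simp_rw [atom_neg]
  have e : ∑' p, ‖inner ℂ (atom g a b (-p)) f‖ ^ 2 = ∑' p, ‖inner ℂ (atom g a b p) f‖ ^ 2 :=
    (Equiv.neg (ℤ × ℤ)).tsum_eq (fun p => ‖inner ℂ (atom g a b p) f‖ ^ 2)
  rw [e]
  exact ⟨(Equiv.neg (ℤ × ℤ)).summable_iff.2 (h f).1, (h f).2⟩

theorem IsDualWindow.neg {g γ : L2R} {a b : ℝ} (h : IsDualWindow g a b γ) :
    IsDualWindow g (-a) (-b) γ := by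
  unfold IsDualWindow
  simp_rw [atom_neg]
  exact (Equiv.neg (ℤ × ℤ)).hasSum_iff.2 h

/-- The dual window satisfies the Wexler-Raz relations and lies in the closed span of the adjoint
system. -/
theorem IsFrame.dualWindow_spec {g γ : L2R} {a b : ℝ} (hab : 0 < a * b)
    (hg : IsFrame g a b) (hγ : IsDualWindow g a b γ) :
    (∀ p, inner ℂ (adjAtom g a b p) γ = sigma a b p) ∧ γ ∈ adjSpan g a b := by
  rcases mul_pos_iff.1 hab with ⟨ha, hb⟩ | ⟨ha, hb⟩
  · exact ⟨hg.inner_adjAtom_dualWindow ha hb hγ, hg.dualWindow_mem_adjSpan ha hb hγ⟩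
  -- When both a and b are negative, changing both signs only reindexes the two systems by p ↦ -p.
  · have h₁ := hg.neg.inner_adjAtom_dualWindow (neg_pos.2 ha) (neg_pos.2 hb) hγ.neg
    have h₂ := hg.neg.dualWindow_mem_adjSpan (neg_pos.2 ha) (neg_pos.2 hb) hγ.neg
    refine ⟨fun p => ?_, ?_⟩
    · have := h₁ (-p)
      rw [adjAtom_neg, neg_neg] at this
      simp only [this, sigma, neg_mul_neg, ← Prod.zero_eq_mk, neg_eq_zero]
    · have e : Set.range (adjAtom g (-a) (-b)) = Set.range (adjAtom g a b) := by
        rw [← (Equiv.neg (ℤ × ℤ)).surjective.range_comp (adjAtom g a b)]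
        exact congrArg Set.range (funext (adjAtom_neg g a b))
      rwa [adjSpan, e] at h₂

/-! ### Finite sections and convergence -/

/-- The adjoint shifts of γ are biorthogonal to those of g up to nonzero factors. A kernel vector c
satisfies ‖H_n* c‖² = ⟨H_n H_n* c, c⟩ = 0, and pairing H_n* c with the shifts of γ kills each entry
of c. -/
theorem isUnit_gramSection {g γ : L2R} {a b : ℝ} (hab : a * b ≠ 0)
    (h : ∀ p, inner ℂ (adjAtom g a b p) γ = sigma a b p) (n : ℕ) :
    IsUnit (gramSection g a b n) := by
  rw [← Matrix.mulVec_injective_iff_isUnit]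
  refine (injective_iff_map_eq_zero (gramSection g a b n).mulVecLin).2 fun c hc => ?_
  have h₁ : ∑ p : Box n, c p • adjAtom g a b p = 0 := by
    have e := gramSection_mulVec g a b n (WithLp.toLp 2 c)
    rw [show (gramSection g a b n).mulVec c = 0 from hc, WithLp.toLp_zero] at e
    have := adjoint_analysis_apply g a b n (WithLp.toLp 2 c)
    rw [← this, ← inner_self_eq_zero (𝕜 := ℂ), ContinuousLinearMap.adjoint_inner_left, ← e,
      inner_zero_right]
  funext q
  have h₂ : ∀ p : ℤ × ℤ, p ≠ q →
      inner ℂ (atom γ (1 / b) (1 / a) q) (adjAtom g a b p) = (0 : ℂ) := fun p hp => by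
    obtain ⟨d, hd, e⟩ := shift_atom g (1 / b) (1 / a) (p - q) q
    rw [sub_add_cancel] at e
    have hd0 : d ≠ 0 := by
      rintro rfl
      simp at hd
    have : inner ℂ (atom γ (1 / b) (1 / a) q) (d • adjAtom g a b p) = (0 : ℂ) := by
      rw [adjAtom, ← e, atom, inner_shift_shift, ← inner_conj_symm]
      have := h (p - q)
      rw [adjAtom] at this
      rw [this, sigma, if_neg (by simpa [sub_eq_zero, ← Prod.zero_eq_mk] using hp), map_zero]
    rwa [inner_smul_right, mul_eq_zero, or_iff_right hd0] at this
  have h₃ : inner ℂ (atom γ (1 / b) (1 / a) q) (adjAtom g a b q) ≠ (0 : ℂ) := by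
    rw [adjAtom, atom, atom, inner_shift_shift, ← inner_conj_symm]
    have := h (0, 0)
    simp only [adjAtom, atom, Int.cast_zero, zero_mul, shift_zero, sigma, if_true] at this
    rw [this]
    simpa using hab
  have h₄ := congrArg (fun u => (inner ℂ (atom γ (1 / b) (1 / a) q) u : ℂ)) h₁
  simp only [inner_sum, inner_smul_right, inner_zero_right] at h₄
  rw [Finset.sum_eq_single q (fun p _ hp => by
    rw [h₂ p (fun h => hp (Subtype.ext h)), mul_zero]) (by simp)] at h₄
  exact (mul_eq_zero.1 h₄).resolve_right h₃

theorem approxDual_mem_span (g : L2R) (a b : ℝ) (n : ℕ) :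
    approxDual g a b n ∈ Submodule.span ℂ (Set.range fun p : Box n => adjAtom g a b p) := by
  rw [approxDual, adjoint_analysis_apply]
  exact Submodule.sum_mem _ fun p _ => Submodule.smul_mem _ _ (Submodule.subset_span ⟨p, rfl⟩)

theorem analysis_approxDual {g : L2R} {a b : ℝ} {n : ℕ} (h : IsUnit (gramSection g a b n)) :
    analysis g a b n (approxDual g a b n) = WithLp.toLp 2 (sigmaSection a b n) := by
  rw [approxDual, ← gramSection_mulVec, Matrix.mulVec_mulVec,
    Matrix.mul_nonsing_inv _ ((Matrix.isUnit_iff_isUnit_det _).1 h), Matrix.one_mulVec]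

/-- The error is orthogonal to the span of the box atoms, by Wexler-Raz and `analysis_approxDual`;
Pythagoras gives best approximation. -/
theorem norm_sub_approxDual_le {g γ : L2R} {a b : ℝ} {n : ℕ} (hu : IsUnit (gramSection g a b n))
    (h : ∀ p, inner ℂ (adjAtom g a b p) γ = sigma a b p) {v : L2R}
    (hv : v ∈ Submodule.span ℂ (Set.range fun p : Box n => adjAtom g a b p)) :
    ‖γ - approxDual g a b n‖ ≤ ‖γ - v‖ := by
  have h₁ : ∀ w ∈ Submodule.span ℂ (Set.range fun p : Box n => adjAtom g a b p),
      inner ℂ w (γ - approxDual g a b n) = (0 : ℂ) := fun w hw => by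
    induction hw using Submodule.span_induction with
    | mem w hw =>
      obtain ⟨p, rfl⟩ := hw
      have := congrArg (fun u : EuclideanSpace ℂ (Box n) => u p) (analysis_approxDual hu)
      simp only [analysis_apply] at this
      rw [inner_sub_right, h, this]
      exact sub_self _
    | zero => exact inner_zero_left _
    | add u w _ _ hu hw => rw [inner_add_left, hu, hw, add_zero]
    | smul c u _ hu => rw [inner_smul_left, hu, mul_zero]
  have h₂ := norm_add_sq_eq_norm_sq_add_norm_sq_of_inner_eq_zero (𝕜 := ℂ) _ _
    (h₁ _ (Submodule.sub_mem _ (approxDual_mem_span g a b n) hv))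
  rw [sub_add_sub_cancel'] at h₂
  refine (mul_self_le_mul_self_iff (norm_nonneg _) (norm_nonneg _)).2 ?_
  rw [h₂]
  exact le_add_of_nonneg_left (mul_self_nonneg _)

theorem span_range_adjAtom_subset (g : L2R) (a b : ℝ) {v : L2R}
    (hv : v ∈ Submodule.span ℂ (Set.range (adjAtom g a b))) :
    ∀ᶠ n in atTop, v ∈ Submodule.span ℂ (Set.range fun p : Box n => adjAtom g a b p) := by
  induction hv using Submodule.span_induction with
  | mem w hw =>
    obtain ⟨p, rfl⟩ := hw
    filter_upwards [eventually_ge_atTop (p.1.natAbs + p.2.natAbs)] with n hn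
    refine Submodule.subset_span ⟨⟨p, ?_⟩, rfl⟩
    simp only [Finset.mem_product, Finset.mem_Icc]
    omega
  | zero => exact Eventually.of_forall fun n => Submodule.zero_mem _
  | add u w _ _ hu hw =>
    filter_upwards [hu, hw] with n h₁ h₂ using Submodule.add_mem _ h₁ h₂
  | smul c u _ hu => filter_upwards [hu] with n h₁ using Submodule.smul_mem _ c h₁

theorem tendsto_approxDual {g γ : L2R} {a b : ℝ} (hu : ∀ n, IsUnit (gramSection g a b n))
    (h : ∀ p, inner ℂ (adjAtom g a b p) γ = sigma a b p) (hγ : γ ∈ adjSpan g a b) :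
    Tendsto (fun n : ℕ => ‖γ - approxDual g a b n‖) atTop (𝓝 0) := by
  refine Metric.tendsto_nhds.2 fun ε hε => ?_
  obtain ⟨v, hv, hd⟩ := Metric.mem_closure_iff.1 hγ ε hε
  filter_upwards [span_range_adjAtom_subset g a b hv] with n hn
  rw [Real.dist_eq, sub_zero, abs_norm]
  exact (norm_sub_approxDual_le (hu n) h hn).trans_lt (by rwa [← dist_eq_norm])

end GaborFrame

theorem mainTheorem3 (a b : ℝ) (hab : 0 < a * b) (g : GaborFrame.L2R)
    (hg : GaborFrame.IsFrame g a b) :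
    (∃! γ : GaborFrame.L2R, GaborFrame.IsDualWindow g a b γ) ∧
    (∀ n : ℕ, IsUnit (GaborFrame.gramSection g a b n)) ∧
    ∀ γ : GaborFrame.L2R, GaborFrame.IsDualWindow g a b γ →
      Tendsto (fun n : ℕ => ‖γ - GaborFrame.approxDual g a b n‖) atTop (𝓝 0) := by
  obtain ⟨S, hS, -, -⟩ := hg.exists_frameOperator
  obtain ⟨γ, hSγ⟩ := S.surjective g
  have hγ : GaborFrame.IsDualWindow g a b γ := hSγ ▸ hS γ
  have hu := GaborFrame.isUnit_gramSection hab.ne' (hg.dualWindow_spec hab hγ).1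
  refine ⟨⟨γ, hγ, fun γ' hγ' => S.injective ?_⟩, hu, fun γ' hγ' => ?_⟩
  · rw [hSγ]
    exact (hS γ').unique hγ'
  · have h := hg.dualWindow_spec hab hγ'
    exact GaborFrame.tendsto_approxDual hu h.1 h.2
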